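/- Let $S=\prod_p p^{\varepsilon_p}$, $\varepsilon_p\in\{0,1,\dots,\infty\}$, be a supernatural number with $\sum_p\varepsilon_p=\infty$, and let $\mathbb Z/S\mathbb Z=\prod_p\mathbb Z/p^{\varepsilon_p}\mathbb Z$ with the product topology (where $\mathbb Z/p^\infty\mathbb Z=\mathbb Z_p$, the $p$-adic integers), which contains $\mathbb Z$ diagonally. Let $\{E_l\}_{l\in\mathbb Z}$ and $\{E_k^+\}_{k\ge 0}$ be the canonical bases of $H=\ell^2(\mathbb Z)$ and $H_+=\ell^2(\mathbb Z_{\ge0})$. Put $VE_l=E_{l+1}$, $UE_k^+=E_{k+1}^+$ and, for $f\in C(\mathbb Z/S\mathbb Z)$, $m_fE_l=f(l)E_l$, $M_fE_k^+=f(k)E_k^+$. Let $B_S=C^*\{V,m_f : f\in C(\mathbb Z/S\mathbb Z)\}\subseteq B(H)$ and $A_S=C^*\{U,M_f : f\in C(\mathbb Z/S\mathbb Z)\}\subseteq B(H_+)$. Let $T(b)=P_{\ge0}\,b\,s$ be the Toeplitz map $B(H)\to B(H_+)$, where $sE_k^+=E_k$, and $P_{\ge0}E_k=E_k^+$ for $k\ge0$,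 $P_{\ge0}E_k=0$ for $k<0$. Let $\mathcal K^\infty$ be the set of operators $c=\sum_{k,j\ge0}c_{kj}P_{kj}$ on $H_+$ with rapidly decaying coefficients, where $P_{kj}x=\langle E_j^+,x\rangle E_k^+$. Let $B_S^\infty$ be the set of $b=\sum_{n\in\mathbb Z}V^nm_{f_n}\in B_S$ such that $\{\|f_n\|\}$ is rapidly decaying and $V^lbV^{-l}=b$ for some positive integer $l$ dividing $S$. Finally, let $$A_S^\infty=\{T(b)+c : b\in B_S^\infty,\ c\in\mathcal K^\infty\}\subseteq A_S .$$ **Theorem.** The algebra $A_S^\infty$ is closed under the smooth functional calculus of self-adjoint elements: if $a\in A_S^\infty$ is self-adjoint and $f$ is a complex-valued $C^\infty$ function on an open set $W\subseteq\mathbb R$ that contains the spectrum of $a$, then $f(a)\in A_S^\infty$. -/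

import Mathlib

open scoped ENNReal ContDiff InnerProductSpace lp

noncomputable section

namespace BunceDeddens

/-! ### Supernatural numbers and the `S`-adic ring -/

instance factPrime (p : Nat.Primes) : Fact (p : ℕ).Prime := ⟨p.2⟩

/-- A supernatural number `S = ∏ p ^ ε_p`, given by its exponents `ε_p ∈ {0, 1, …, ∞}`. -/
abbrev Supernatural : Type := Nat.Primes → ℕ∞

/-- `S` is infinite: `∑ ε_p = ∞` (a sum of extended nonnegative numbers). -/
def Supernatural.IsInfinite (S : Supernatural) : Prop :=
  ∑' p : Nat.Primes, ((S p : ℕ∞) : ℝ≥0∞) = ⊤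

/-- The positive integer `l` divides `S`: `v_p(l) ≤ ε_p` for all primes `p`. -/
def Supernatural.Divides (l : ℕ) (S : Supernatural) : Prop :=
  0 < l ∧ ∀ p : Nat.Primes, ((l.factorization p : ℕ) : ℕ∞) ≤ S p

/-- The factor `ℤ / p^e ℤ`, which is the ring `ℤ_p` of `p`-adic integers for `e = ∞`. -/
def PrimaryFactor (p : Nat.Primes) : ℕ∞ → Type
  | none => ℤ_[(p : ℕ)]
  | some n => ZMod ((p : ℕ) ^ n)

instance (p : Nat.Primes) : (e : ℕ∞) → CommRing (PrimaryFactor p e)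
  | none => inferInstanceAs (CommRing ℤ_[(p : ℕ)])
  | some n => inferInstanceAs (CommRing (ZMod ((p : ℕ) ^ n)))

/-- The usual topology on `ℤ_p`, the discrete topology on `ℤ / p^n ℤ`. -/
instance (p : Nat.Primes) : (e : ℕ∞) → TopologicalSpace (PrimaryFactor p e)
  | none => inferInstanceAs (TopologicalSpace ℤ_[(p : ℕ)])
  | some n => inferInstanceAs (TopologicalSpace (ZMod ((p : ℕ) ^ n)))

instance (p : Nat.Primes) : (e : ℕ∞) → CompactSpace (PrimaryFactor p e)
  | none => inferInstanceAs (CompactSpace ℤ_[(p : ℕ)])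
  | some n =>
    haveI : NeZero ((p : ℕ) ^ n) := ⟨pow_ne_zero n p.2.ne_zero⟩
    inferInstanceAs (CompactSpace (ZMod ((p : ℕ) ^ n)))

/-- The ring `ℤ/Sℤ = ∏_p ℤ/p^{ε_p}ℤ` with the product topology. An integer `k` is regarded as the
element `(k : SAdic S)` with components `k mod p^{ε_p}`. -/
abbrev SAdic (S : Supernatural) : Type := ∀ p : Nat.Primes, PrimaryFactor p (S p)

/-! ### Hilbert spaces and basic operators -/

/-- The canonical basis vector `E_i` of `ℓ²(ι)`. -/
def E {ι : Type} [DecidableEq ι] (i : ι) : ℓ²(ι, ℂ) := lp.single 2 i 1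

theorem orthonormal_E {ι : Type} [DecidableEq ι] : Orthonormal ℂ (E : ι → ℓ²(ι, ℂ)) := by
  rw [orthonormal_iff_ite]
  intro i j
  simp [E, lp.inner_single_left, lp.single_apply, Pi.single_apply]

/-- For an injective map `σ : ι → κ`, the isometry `ℓ²(ι) → ℓ²(κ)` with `E_i ↦ E_{σ i}`. -/
def basisMap {ι κ : Type} [DecidableEq κ] (σ : ι → κ) (hσ : Function.Injective σ) :
    ℓ²(ι, ℂ) →ₗᵢ[ℂ] ℓ²(κ, ℂ) :=
  (orthonormal_E.comp σ hσ).orthogonalFamily.linearIsometry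

theorem basisMap_E {ι κ : Type} [DecidableEq ι] [DecidableEq κ] (σ : ι → κ)
    (hσ : Function.Injective σ) (i : ι) : basisMap σ hσ (E i) = E (σ i) := by
  rw [basisMap, E, OrthogonalFamily.linearIsometry_apply_single]
  simp

/-- The diagonal operator on `ℓ²(ι)` with `E_i ↦ f (γ i) • E_i`, where `γ : ι → X`. -/
def diagonal {ι X : Type} [TopologicalSpace X] [CompactSpace X] (γ : ι → X) (f : C(X, ℂ)) :
    ℓ²(ι, ℂ) →L[ℂ] ℓ²(ι, ℂ) :=
  lp.mapCLM 2 (fun i => ContinuousLinearMap.lsmul ℂ ℂ (f (γ i))) (norm_nonneg f)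
    (fun _ => (ContinuousLinearMap.opNorm_lsmul_apply_le _).trans (f.norm_coe_le_norm _))

theorem diagonal_apply {ι X : Type} [TopologicalSpace X] [CompactSpace X] (γ : ι → X)
    (f : C(X, ℂ)) (x : ℓ²(ι, ℂ)) (i : ι) : diagonal γ f x i = f (γ i) * x i := rfl

theorem diagonal_E {ι X : Type} [DecidableEq ι] [TopologicalSpace X] [CompactSpace X] (γ : ι → X)
    (f : C(X, ℂ)) (i : ι) : diagonal γ f (E i) = f (γ i) • E i := by
  ext j
  rw [diagonal_apply]
  by_cases h : j = i
  · subst h; simp [E]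
  · simp [E, h]

/-- `H = ℓ²(ℤ)`. -/
abbrev H : Type := ℓ²(ℤ, ℂ)

/-- `H₊ = ℓ²(ℤ_{≥0})`. -/
abbrev HPlus : Type := ℓ²(ℕ, ℂ)

/-- The `n`-th power `V^n` of the bilateral shift `V`, that is `E_l ↦ E_{l+n}`, for `n ∈ ℤ`. -/
def V (n : ℤ) : H →L[ℂ] H :=
  (basisMap (fun l : ℤ => l + n) (add_left_injective n)).toContinuousLinearMap

/-- The unilateral shift `U E⁺_k = E⁺_{k+1}`. -/
def U : HPlus →L[ℂ] HPlus :=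
  (basisMap (fun k : ℕ => k + 1) (add_left_injective 1)).toContinuousLinearMap

/-- `m_f E_l = f(l) E_l`. -/
def m {S : Supernatural} (f : C(SAdic S, ℂ)) : H →L[ℂ] H :=
  diagonal (fun l : ℤ => (l : SAdic S)) f

/-- `M_f E⁺_k = f(k) E⁺_k`. -/
def M {S : Supernatural} (f : C(SAdic S, ℂ)) : HPlus →L[ℂ] HPlus :=
  diagonal (fun k : ℕ => (k : SAdic S)) f

theorem V_E (n l : ℤ) : V n (E l) = E (l + n) := basisMap_E _ (add_left_injective n) l

theorem clm_ext {ι : Type} [DecidableEq ι] {F : Type} [NormedAddCommGroup F] [NormedSpace ℂ F]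
    {a b : ℓ²(ι, ℂ) →L[ℂ] F} (h : ∀ i, a (E i) = b (E i)) : a = b := by
  refine lp.ext_continuousLinearMap (by simp) fun i => ?_
  ext
  exact h i

/-- `V n` is indeed the `n`-th power of the unitary `V 1`. -/
theorem V_zero : V 0 = 1 := clm_ext fun l => by simp [V_E]

theorem V_mul (n k : ℤ) : V n * V k = V (n + k) := clm_ext fun l => by
  simp [V_E, add_assoc, add_comm k n]

/-! ### The algebras `B_S` and `A_S` -/

/-- The unital C*-algebra of operators generated by a set. -/
def generatedCStar {G : Type} [NormedAddCommGroup G] [InnerProductSpace ℂ G] [CompleteSpace G]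
    (X : Set (G →L[ℂ] G)) : StarSubalgebra ℂ (G →L[ℂ] G) :=
  (StarAlgebra.adjoin ℂ X).topologicalClosure

/-- The Bunce-Deddens algebra `B_S = C*{V, m_f : f ∈ C(ℤ/Sℤ)}`. -/
def BD (S : Supernatural) : StarSubalgebra ℂ (H →L[ℂ] H) :=
  generatedCStar (insert (V 1) (Set.range (m (S := S))))

/-- The Bunce-Deddens-Toeplitz algebra `A_S = C*{U, M_f : f ∈ C(ℤ/Sℤ)}`. -/
def BDT (S : Supernatural) : StarSubalgebra ℂ (HPlus →L[ℂ] HPlus) :=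
  generatedCStar (insert U (Set.range (M (S := S))))

/-! ### The Toeplitz map -/

/-- The isometry `s : H₊ → H`, `s E⁺_k = E_k`. -/
def s : HPlus →L[ℂ] H :=
  (basisMap (fun k : ℕ => (k : ℤ)) Nat.cast_injective).toContinuousLinearMap

/-- `P_{≥0} : H → H₊`, the adjoint of `s`; see `PNonneg_E_of_nonneg` and `PNonneg_E_of_neg`. -/
def PNonneg : H →L[ℂ] HPlus := ContinuousLinearMap.adjoint s

theorem s_E (k : ℕ) : s (E k) = E (k : ℤ) := basisMap_E _ Nat.cast_injective k

theorem PNonneg_apply (x : H) (k : ℕ) : PNonneg x k = x (k : ℤ) := by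
  have h := ContinuousLinearMap.adjoint_inner_right s (E k) x
  rw [s_E] at h
  simpa [E, lp.inner_single_left, PNonneg] using h

theorem PNonneg_E_of_nonneg (k : ℕ) : PNonneg (E (k : ℤ)) = E k := by
  ext j
  rw [PNonneg_apply]
  simp [E, lp.single_apply, Pi.single_apply]

theorem PNonneg_E_of_neg (l : ℤ) (hl : l < 0) : PNonneg (E l) = 0 := by
  ext j
  have : (j : ℤ) ≠ l := by omega
  rw [PNonneg_apply]
  simp [E, this]

/-- The Toeplitz map `T(b) = P_{≥0} b s`. -/
def T (b : H →L[ℂ] H) : HPlus →L[ℂ] HPlus := PNonneg ∘L b ∘L s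

/-! ### Smooth subalgebras -/

/-- The matrix unit `P_{kj}`: `x ↦ ⟪E⁺_j, x⟫ E⁺_k`. -/
def matrixUnit (k j : ℕ) : HPlus →L[ℂ] HPlus := InnerProductSpace.rankOne ℂ (E k) (E j)

/-- Smooth compact operators `c = ∑ c_{kj} P_{kj}` with rapidly decaying coefficients. -/
def smoothCompact : Set (HPlus →L[ℂ] HPlus) :=
  {c | ∃ q : ℕ → ℕ → ℂ,
    (∀ N : ℕ, ∃ C : ℝ, ∀ k j : ℕ, (1 + (k : ℝ) + (j : ℝ)) ^ N * ‖q k j‖ ≤ C) ∧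
    HasSum (fun i : ℕ × ℕ => q i.1 i.2 • matrixUnit i.1 i.2) c}

/-- The smooth Bunce-Deddens algebra `B_S^∞`: all `b = ∑ V^n m_{f_n}` in `B_S` (norm convergent)
such that `‖f_n‖` decays rapidly and `V^l b V^{-l} = b` for some `l` dividing `S`. -/
def smoothBD (S : Supernatural) : Set (H →L[ℂ] H) :=
  {b | b ∈ BD S ∧
    (∃ f : ℤ → C(SAdic S, ℂ),
      (∀ N : ℕ, ∃ C : ℝ, ∀ n : ℤ, (1 + |(n : ℝ)|) ^ N * ‖f n‖ ≤ C) ∧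
      HasSum (fun n : ℤ => V n * m (f n)) b) ∧
    ∃ l : ℕ, Supernatural.Divides l S ∧ V l * b * V (-l) = b}

/-- The smooth Bunce-Deddens-Toeplitz algebra
`A_S^∞ = {T(b) + c : b ∈ B_S^∞, c ∈ 𝓚^∞} ⊆ A_S`. -/
def smoothBDT (S : Supernatural) : Set (HPlus →L[ℂ] HPlus) :=
  {a | a ∈ BDT S ∧ ∃ b ∈ smoothBD S, ∃ c ∈ smoothCompact, a = T b + c}

end BunceDeddens

end

noncomputable section

namespace BunceDeddens

/-! ### Matrix entries -/

section Entries

variable {ι : Type} [DecidableEq ι]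

/-! An operator in `BDT S` belongs to `smoothBDT S` exactly when, for some `l` dividing `S`, its
matrix decays rapidly off the diagonal and the differences `x (k+l, j+l) - x (k, j)` decay rapidly
in both indices (`exists_isSmooth_of_mem_smoothBDT`, `IsSmooth.mem_smoothBDT`). With `D` the number
operator, these two conditions say that all iterated commutators of `x` with `D` and all products `D
^ n (x U^l - U^l x)` are bounded. To avoid unbounded operators, `D` is truncated at `N` and the
bounds are required uniformly in `N`; this is `IsSmooth l x`.

The commutator with `D` and left multiplication by `D` satisfy a common twisted Leibniz rule, so
along the powers `x ^ m` the bounds grow at most polynomially in `m` times `ρ ^ m`, where `ρ ≥ max 1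
‖x‖` (`exists_twisted_pow_bound`). Hence exponentials of smooth operators are smooth. For
self-adjoint `a` the exponentials `e^{±iθa}` have norm at most `1`, so `ρ = 1` is allowed and the
bounds on their powers are polynomial. Cut off near the spectrum, `f` has a Fourier series with
rapidly decaying coefficients, and `f(a) = ∑ c_n e^{inθa}` is smooth with the same `l`
(`IsSmooth.cfc`). -/

theorem E_apply (i j : ι) : (E i : ℓ²(ι, ℂ)) j = if j = i then 1 else 0 := by
  simp [E, lp.single_apply, Pi.single_apply]

theorem norm_E (i : ι) : ‖(E i : ℓ²(ι, ℂ))‖ = 1 := orthonormal_E.1 i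

/-- The matrix entry `⟪E_k, x E_j⟫` as a continuous linear functional of the operator `x`. -/
def entry (k j : ι) : (ℓ²(ι, ℂ) →L[ℂ] ℓ²(ι, ℂ)) →L[ℂ] ℂ :=
  (innerSL ℂ (E k)).comp (ContinuousLinearMap.apply ℂ _ (E j))

theorem entry_apply (k j : ι) (x : ℓ²(ι, ℂ) →L[ℂ] ℓ²(ι, ℂ)) : entry k j x = x (E j) k := by
  simp [entry, E, lp.inner_single_left]

theorem norm_entry_le (k j : ι) (x : ℓ²(ι, ℂ) →L[ℂ] ℓ²(ι, ℂ)) : ‖entry k j x‖ ≤ ‖x‖ := by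
  rw [entry_apply]
  refine (lp.norm_apply_le_norm two_ne_zero _ _).trans ?_
  simpa [norm_E] using x.le_opNorm (E j)

theorem entry_ext {x y : ℓ²(ι, ℂ) →L[ℂ] ℓ²(ι, ℂ)} (h : ∀ k j, entry k j x = entry k j y) :
    x = y := by
  refine clm_ext fun j => ?_
  ext k
  simpa [entry_apply] using h k j

theorem hasSum_entry_mul (x : ℓ²(ι, ℂ) →L[ℂ] ℓ²(ι, ℂ)) (z : ℓ²(ι, ℂ)) (k : ι) :
    HasSum (fun j => entry k j x * z j) (x z k) := by
  have h := (lp.hasSum_single (by simp) z).mapL ((innerSL ℂ (E k)).comp x)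
  have h1 : ∀ y : ℓ²(ι, ℂ), ((innerSL ℂ (E k)).comp x) y = x y k := fun y => by
    simp [E, lp.inner_single_left]
  rw [h1] at h
  refine h.congr_fun fun j => ?_
  have h2 : lp.single 2 j (z j) = z j • (E j : ℓ²(ι, ℂ)) := by
    rw [E, ← lp.single_smul]; simp
  rw [h1, h2, entry_apply, map_smul, lp.coeFn_smul, Pi.smul_apply, smul_eq_mul, mul_comm]

/-- The Schur test. -/
theorem opNorm_le_of_schur {x : ℓ²(ι, ℂ) →L[ℂ] ℓ²(ι, ℂ)} {r : ι → ι → ℝ} {C : ℝ} (hC : 0 ≤ C)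
    (hrow : ∀ k (F : Finset ι), ∑ j ∈ F, r k j ≤ C) (hcol : ∀ j (F : Finset ι), ∑ k ∈ F, r k j ≤ C)
    (h : ∀ k j, ‖entry k j x‖ ≤ r k j) : ‖x‖ ≤ C := by
  have hr : ∀ k j, 0 ≤ r k j := fun k j => (norm_nonneg _).trans (h k j)
  refine x.opNorm_le_bound hC fun z => ?_
  refine lp.norm_le_of_forall_sum_le (by simp) (by positivity) fun G => ?_
  have key : ∀ F : Finset ι, ∑ k ∈ G, ‖∑ j ∈ F, entry k j x * z j‖ ^ 2 ≤ (C * ‖z‖) ^ 2 := by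
    intro F
    have h1 : ∀ k ∈ G, ‖∑ j ∈ F, entry k j x * z j‖ ^ 2 ≤ C * ∑ j ∈ F, r k j * ‖z j‖ ^ 2 := by
      intro k _
      calc ‖∑ j ∈ F, entry k j x * z j‖ ^ 2 ≤ (∑ j ∈ F, r k j * ‖z j‖) ^ 2 := by
            gcongr
            refine (norm_sum_le _ _).trans (Finset.sum_le_sum fun j _ => ?_)
            rw [norm_mul]
            exact mul_le_mul_of_nonneg_right (h k j) (norm_nonneg _)
        _ ≤ (∑ j ∈ F, r k j) * ∑ j ∈ F, r k j * ‖z j‖ ^ 2 := by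
            -- Cauchy-Schwarz with the weights `r k j`. The row bound yields one factor `C` here,
            -- and the column bound a second one after the sums are exchanged.
            refine Finset.sum_sq_le_sum_mul_sum_of_sq_le_mul F (fun j _ => hr k j)
              (fun j _ => mul_nonneg (hr k j) (sq_nonneg _)) fun j _ => le_of_eq (by ring)
        _ ≤ _ := mul_le_mul_of_nonneg_right (hrow k F)
            (Finset.sum_nonneg fun j _ => mul_nonneg (hr k j) (sq_nonneg _))
    calc _ ≤ ∑ k ∈ G, C * ∑ j ∈ F, r k j * ‖z j‖ ^ 2 := Finset.sum_le_sum h1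
      _ = C * ∑ j ∈ F, (∑ k ∈ G, r k j) * ‖z j‖ ^ 2 := by
          rw [← Finset.mul_sum, Finset.sum_comm]; simp_rw [Finset.sum_mul]
      _ ≤ C * ∑ j ∈ F, C * ‖z j‖ ^ 2 := by
          gcongr with j
          exact hcol j G
      _ = C ^ 2 * ∑ j ∈ F, ‖z j‖ ^ 2 := by rw [← Finset.mul_sum]; ring
      _ ≤ C ^ 2 * ‖z‖ ^ 2 := by
          gcongr
          simpa using lp.sum_rpow_le_norm_rpow (p := 2) (by simp) z F
      _ = _ := by ring
  have hlim : Filter.Tendsto (fun F : Finset ι => ∑ k ∈ G, ‖∑ j ∈ F, entry k j x * z j‖ ^ 2)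
      Filter.atTop (nhds (∑ k ∈ G, ‖x z k‖ ^ 2)) :=
    tendsto_finsetSum _ fun k _ => ((hasSum_entry_mul x z k).norm.pow 2)
  simpa using le_of_tendsto' hlim key

end Entries

/-! ### The truncated number operator -/

/-- The bounded truncation `E⁺_k ↦ (1 + min k N) E⁺_k` of the number operator. -/
def number (N : ℕ) : HPlus →L[ℂ] HPlus :=
  diagonal (fun k : ℕ => (⟨min k N, by omega⟩ : Fin (N + 1)))
    ⟨fun i => 1 + ((i : ℕ) : ℂ), continuous_of_discreteTopology⟩

/-- The commutator with the truncated number operator. -/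
def commNumber (N : ℕ) : (HPlus →L[ℂ] HPlus) →L[ℂ] (HPlus →L[ℂ] HPlus) :=
  ContinuousLinearMap.mul ℂ _ (number N) - (ContinuousLinearMap.mul ℂ _).flip (number N)

/-- The left multiplication by the truncated number operator. -/
def mulNumber (N : ℕ) : (HPlus →L[ℂ] HPlus) →L[ℂ] (HPlus →L[ℂ] HPlus) :=
  ContinuousLinearMap.mul ℂ _ (number N)

theorem commNumber_apply (N : ℕ) (x : HPlus →L[ℂ] HPlus) :
    commNumber N x = number N * x - x * number N := rfl

theorem mulNumber_apply (N : ℕ) (x : HPlus →L[ℂ] HPlus) : mulNumber N x = number N * x := rfl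

theorem commNumber_mul (N : ℕ) (x y : HPlus →L[ℂ] HPlus) :
    commNumber N (x * y) = commNumber N x * y + x * commNumber N y := by
  simp only [commNumber_apply]; noncomm_ring

/-- `D x y = [D, x] y + x (D y)`: left multiplication by `D` is a derivation twisted by the
commutator, so one estimate serves both conditions of `IsSmooth`. -/
theorem mulNumber_mul (N : ℕ) (x y : HPlus →L[ℂ] HPlus) :
    mulNumber N (x * y) = commNumber N x * y + x * mulNumber N y := by
  simp only [commNumber_apply, mulNumber_apply]; noncomm_ring

theorem mulNumber_pow_mul (N n : ℕ) (x y : HPlus →L[ℂ] HPlus) :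
    (mulNumber N ^ n) (x * y) = (mulNumber N ^ n) x * y := by
  induction n with
  | zero => simp
  | succ n ih => simp only [pow_succ', mul_apply_eq_comp, ih, mulNumber_apply, mul_assoc]

theorem entry_number_mul (N k j : ℕ) (x : HPlus →L[ℂ] HPlus) :
    entry k j (number N * x) = (1 + (min k N : ℕ)) * entry k j x := by
  simp only [entry_apply, mul_apply_eq_comp, number, diagonal_apply]
  rfl

theorem entry_mul_number (N k j : ℕ) (x : HPlus →L[ℂ] HPlus) :
    entry k j (x * number N) = (1 + (min j N : ℕ)) * entry k j x := by
  simp only [entry_apply, mul_apply_eq_comp, number, diagonal_E, map_smul, lp.coeFn_smul,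
    Pi.smul_apply, smul_eq_mul]
  rfl

theorem entry_mulNumber_pow (N n k j : ℕ) (x : HPlus →L[ℂ] HPlus) :
    entry k j ((mulNumber N ^ n) x) = (1 + (min k N : ℕ)) ^ n * entry k j x := by
  induction n with
  | zero => simp
  | succ n ih =>
    rw [pow_succ', mul_apply_eq_comp, mulNumber_apply, entry_number_mul, ih]; ring

theorem entry_commNumber_pow (N n k j : ℕ) (x : HPlus →L[ℂ] HPlus) :
    entry k j ((commNumber N ^ n) x) = ((min k N : ℕ) - (min j N : ℕ)) ^ n * entry k j x := by
  induction n with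
  | zero => simp
  | succ n ih =>
    rw [pow_succ', mul_apply_eq_comp, commNumber_apply, map_sub, entry_number_mul,
      entry_mul_number, ih]; ring

/-! ### Powers of the unilateral shift and commutators with them. -/

theorem U_pow_E (l j : ℕ) : (U ^ l) (E j) = E (j + l) := by
  induction l with
  | zero => simp
  | succ l ih =>
    rw [pow_succ', mul_apply_eq_comp, ih]
    exact basisMap_E _ (add_left_injective 1) _

theorem U_pow_apply (l k : ℕ) (z : HPlus) : (U ^ l) z k = if l ≤ k then z (k - l) else 0 := by
  have h := hasSum_entry_mul (U ^ l) z k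
  refine h.unique ?_
  simp only [entry_apply, U_pow_E, E_apply]
  split_ifs with hl
  · convert hasSum_single (k - l) fun j hj => ?_ using 1
    · simp [hl]
    · rw [if_neg (by omega), zero_mul]
  · convert hasSum_zero with j
    rw [if_neg (by omega), zero_mul]

/-- In the rows `k ≥ l` this is the difference of two entries of `x` one step `(l, l)` apart; the
first `l` rows have no partner, because `U` is not invertible. -/
theorem entry_commutator_U_pow (l k j : ℕ) (x : HPlus →L[ℂ] HPlus) :
    entry k j (x * U ^ l - U ^ l * x)
      = entry k (j + l) x - if l ≤ k then entry (k - l) j x else 0 := by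
  simp only [entry_apply, mul_apply_eq_comp, sub_apply, U_pow_E,
    lp.coeFn_sub, Pi.sub_apply, U_pow_apply]

/-! ### Estimates for powers under twisted derivations -/

section Powers

variable {A : Type*} [NormedRing A] [NormedAlgebra ℂ A]

theorem twisted_leibniz {d e : A →L[ℂ] A} (h : ∀ x y, e (x * y) = d x * y + x * e y) (x y : A)
    (n : ℕ) : (e ^ n) (x * y)
      = ∑ ij ∈ Finset.HasAntidiagonal.antidiagonal n, n.choose ij.1 • ((d ^ ij.1) x * (e ^ ij.2) y) := by
  induction n with
  | zero => simp
  | succ n ih =>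
    rw [Finset.sum_antidiagonal_choose_succ_nsmul (fun i j => (d ^ i) x * (e ^ j) y) n]
    simp only [pow_succ', mul_apply_eq_comp, ih, map_sum, map_nsmul, h, smul_add,
      Finset.sum_add_distrib]
    rw [add_comm, add_left_cancel_iff]
    refine Finset.sum_congr rfl fun ij hij => ?_
    rw [n.choose_symm_of_eq_add (Finset.HasAntidiagonal.mem_antidiagonal.1 hij).symm]

/-- The term with all of `e ^ n` on `y` is split off with the exact constant `‖x‖`, which fixes the
exponential rate in the recursion below; the remaining terms involve only lower powers of `e`. -/
theorem norm_twisted_leibniz_le {d e : A →L[ℂ] A} (h : ∀ x y, e (x * y) = d x * y + x * e y)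
    (x y : A) (n : ℕ) : ‖(e ^ n) (x * y)‖ ≤ ‖x‖ * ‖(e ^ n) y‖
      + ∑ j ∈ Finset.range n, n.choose (n - j) * (‖(d ^ (n - j)) x‖ * ‖(e ^ j) y‖) := by
  rw [twisted_leibniz h, ← Finset.Nat.sum_antidiagonal_swap,
    Finset.Nat.sum_antidiagonal_eq_sum_range_succ_mk, Finset.sum_range_succ, add_comm]
  refine (norm_add_le _ _).trans (add_le_add ?_ ?_)
  · simpa using norm_mul_le x ((e ^ n) y)
  · refine (norm_sum_le _ _).trans (Finset.sum_le_sum fun j _ => ?_)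
    refine (norm_nsmul_le).trans ?_
    exact mul_le_mul_of_nonneg_left (norm_mul_le _ _) (Nat.cast_nonneg _)

/-- Polynomial growth of the iterates of twisted derivations along a recursion
`z (m + 1) = x * z m + g m`, uniformly in the twisted derivation. -/
theorem exists_twisted_pow_bound {ι : Type*} {d e : ι → A →L[ℂ] A}
    (hde : ∀ i x y, e i (x * y) = d i x * y + x * e i y) {x : A} {ρ : ℝ} (hρ : 1 ≤ ρ)
    (hx : ‖x‖ ≤ ρ) (hd : ∀ n, ∃ C, ∀ i, ‖(d i ^ n) x‖ ≤ C) {z g : ℕ → A}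
    (hz : ∀ m, z (m + 1) = x * z m + g m) (h0 : ∀ n, ∃ C, ∀ i, ‖(e i ^ n) (z 0)‖ ≤ C)
    (hg : ∀ n, ∃ C, ∀ i m, ‖(e i ^ n) (g m)‖ ≤ C * ρ ^ m) (n : ℕ) :
    ∃ C, 0 ≤ C ∧ ∀ i m, ‖(e i ^ n) (z m)‖ ≤ C * (1 + m) ^ (n + 1) * ρ ^ m := by
  choose D hD using hd
  choose B hB using h0
  choose G hG using hg
  induction n using Nat.strong_induction_on with
  | _ n ih =>
  -- The constant for `j ≥ n` is a dummy that lets `choose` produce a function on all of `ℕ`.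
  have ih' : ∀ j, ∃ C, 0 ≤ C ∧ (j < n → ∀ i m,
      ‖(e i ^ j) (z m)‖ ≤ C * (1 + m) ^ (j + 1) * ρ ^ m) := fun j => by
    by_cases hj : j < n
    · obtain ⟨C, h1, h2⟩ := ih j hj
      exact ⟨C, h1, fun _ => h2⟩
    · exact ⟨0, le_rfl, fun h => absurd h hj⟩
  choose C hC0 hC using ih'
  set R := ∑ j ∈ Finset.range n, n.choose (n - j) * (|D (n - j)| * C j) with hR
  have hR0 : 0 ≤ R := Finset.sum_nonneg fun j _ => by have := hC0 j; positivity
  have hρ0 : 0 < ρ := by linarith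
  -- `Q` dominates the initial value and the inhomogeneous terms. Each step multiplies by `ρ` and
  -- adds at most `Q (1 + m) ^ n ρ ^ (m + 1)`, which costs one extra power of `1 + m`.
  set Q := |B n| + |G n| + R with hQ
  have hQ0 : 0 ≤ Q := by positivity
  refine ⟨Q, hQ0, fun i m => ?_⟩
  induction m with
  | zero =>
    have := (hB n i).trans (le_abs_self _)
    have := abs_nonneg (G n)
    simp only [Nat.cast_zero, add_zero, one_pow, mul_one, pow_zero]
    linarith
  | succ m ihm =>
    have hm : (1 : ℝ) ≤ 1 + m := by simp
    have h1 : ∑ j ∈ Finset.range n,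
        n.choose (n - j) * (‖(d i ^ (n - j)) x‖ * ‖(e i ^ j) (z m)‖)
          ≤ R * ((1 + m) ^ n * ρ ^ m) := by
      rw [hR, Finset.sum_mul]
      refine Finset.sum_le_sum fun j hj => ?_
      rw [Finset.mem_range] at hj
      rw [mul_assoc, mul_assoc]
      have := hC0 j
      gcongr
      · exact (hD _ i).trans (le_abs_self _)
      · refine (hC j hj i m).trans ?_
        rw [mul_assoc]
        gcongr ?_ * (?_ * _)
        exact pow_le_pow_right₀ hm hj
    have h2 : ‖(e i ^ n) (g m)‖ ≤ |G n| * ((1 + m) ^ n * ρ ^ m) := by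
      refine (hG n i m).trans ?_
      gcongr
      · exact le_abs_self _
      · exact le_mul_of_one_le_left (by positivity) (one_le_pow₀ hm)
    calc ‖(e i ^ n) (z (m + 1))‖ ≤ ‖(e i ^ n) (x * z m)‖ + ‖(e i ^ n) (g m)‖ := by
          rw [hz, map_add]; exact norm_add_le _ _
      _ ≤ ρ * (Q * (1 + m) ^ (n + 1) * ρ ^ m) + R * ((1 + m) ^ n * ρ ^ m)
            + |G n| * ((1 + m) ^ n * ρ ^ m) := by
          refine add_le_add ((norm_twisted_leibniz_le (hde i) _ _ _).trans
            (add_le_add ?_ h1)) h2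
          gcongr
      _ ≤ ρ * (Q * (1 + m) ^ (n + 1) * ρ ^ m) + Q * ((1 + m) ^ n * (ρ * ρ ^ m)) := by
          have h3 : (1 + m : ℝ) ^ n * ρ ^ m ≤ (1 + m) ^ n * (ρ * ρ ^ m) := by
            gcongr
            exact le_mul_of_one_le_left (by positivity) hρ
          have h4 : (R + |G n|) * ((1 + m : ℝ) ^ n * ρ ^ m) ≤ Q * ((1 + m) ^ n * (ρ * ρ ^ m)) := by
            refine mul_le_mul ?_ h3 (by positivity) hQ0
            rw [hQ]; linarith [abs_nonneg (B n)]
          linarith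
      _ = Q * ((1 + m) ^ n * (2 + m)) * ρ ^ (m + 1) := by ring
      _ ≤ Q * ((2 + m) ^ n * (2 + m)) * ρ ^ (m + 1) := by
          gcongr
          linarith
      _ = _ := by push_cast; ring

end Powers

/-! ### Smooth operators on `H₊` -/

/-- Bounds, uniform in the truncation, for the iterated commutators of `x` with the number operator
and for the products of its powers with `x U^l - U^l x`. -/
structure IsSmooth (l : ℕ) (x : HPlus →L[ℂ] HPlus) : Prop where
  comm : ∀ n, ∃ C, ∀ N, ‖(commNumber N ^ n) x‖ ≤ C
  shift : ∀ n, ∃ C, ∀ N, ‖(mulNumber N ^ n) (x * U ^ l - U ^ l * x)‖ ≤ C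

theorem commNumber_pow_one (N n : ℕ) :
    ‖(commNumber N ^ n) (1 : HPlus →L[ℂ] HPlus)‖ ≤ ‖(1 : HPlus →L[ℂ] HPlus)‖ := by
  cases n with
  | zero => simp
  | succ n => simp [pow_succ, commNumber_apply]

theorem IsSmooth.smul {l : ℕ} {x : HPlus →L[ℂ] HPlus} (h : IsSmooth l x) (c : ℂ) :
    IsSmooth l (c • x) := by
  refine ⟨fun n => ?_, fun n => ?_⟩
  · obtain ⟨C, hC⟩ := h.comm n
    refine ⟨‖c‖ * C, fun N => ?_⟩
    rw [map_smul, norm_smul]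
    gcongr
    exact hC N
  · obtain ⟨C, hC⟩ := h.shift n
    refine ⟨‖c‖ * C, fun N => ?_⟩
    rw [smul_mul_assoc, mul_smul_comm, ← smul_sub, map_smul, norm_smul]
    gcongr
    exact hC N

/-! ### Growth of powers, and power series of smooth operators. -/

theorem IsSmooth.exists_comm_pow_bound {l : ℕ} {x : HPlus →L[ℂ] HPlus} (h : IsSmooth l x) {ρ : ℝ}
    (hρ : 1 ≤ ρ) (hx : ‖x‖ ≤ ρ) (n : ℕ) :
    ∃ C, 0 ≤ C ∧ ∀ N m : ℕ, ‖(commNumber N ^ n) (x ^ m)‖ ≤ C * (1 + m) ^ (n + 1) * ρ ^ m := by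
  refine exists_twisted_pow_bound (d := commNumber) commNumber_mul hρ hx h.comm
    (z := fun m => x ^ m) (g := 0) (fun m => by simp [pow_succ'])
    (fun n => ⟨_, fun N => by simpa using commNumber_pow_one N n⟩) (fun n => ⟨0, by simp⟩) n

/-- Gives `‖1‖ = 1`, needed for the zeroth power in the next lemma. -/
instance : Nontrivial HPlus := ⟨E 0, 0, fun h => by simpa [h] using norm_E (0 : ℕ)⟩

theorem norm_pow_le_of_le {x : HPlus →L[ℂ] HPlus} {ρ : ℝ} (hx : ‖x‖ ≤ ρ) (m : ℕ) :
    ‖x ^ m‖ ≤ ρ ^ m :=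
  (norm_pow_le x m).trans (by gcongr)

/-- The commutators `z m = [x ^ m, U ^ l]` satisfy `z (m + 1) = x z m + [x, U ^ l] x ^ m` and `z 0 =
0`. Left multiplications by `D` act only on the left factor of the last term, which is therefore
`O(ρ ^ m)`. -/
theorem IsSmooth.exists_shift_pow_bound {l : ℕ} {x : HPlus →L[ℂ] HPlus} (h : IsSmooth l x) {ρ : ℝ}
    (hρ : 1 ≤ ρ) (hx : ‖x‖ ≤ ρ) (n : ℕ) :
    ∃ C, 0 ≤ C ∧ ∀ N m : ℕ, ‖(mulNumber N ^ n) (x ^ m * U ^ l - U ^ l * x ^ m)‖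
      ≤ C * (1 + m) ^ (n + 1) * ρ ^ m := by
  refine exists_twisted_pow_bound (d := commNumber) mulNumber_mul hρ hx h.comm
    (z := fun m => x ^ m * U ^ l - U ^ l * x ^ m) (g := fun m => (x * U ^ l - U ^ l * x) * x ^ m)
    (fun m => by simp only [pow_succ' x]; noncomm_ring)
    (fun n => ⟨0, fun N => by simp⟩) (fun n => ?_) n
  obtain ⟨C, hC⟩ := h.shift n
  refine ⟨C, fun N m => ?_⟩
  rw [mulNumber_pow_mul]
  exact (norm_mul_le _ _).trans (mul_le_mul (hC N) (norm_pow_le_of_le hx m) (norm_nonneg _)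
    ((norm_nonneg _).trans (hC N)))

/-- For each fixed `N` the maps are continuous, so they may be applied termwise; the majorants do
not depend on `N`. -/
theorem isSmooth_of_hasSum {ι : Type*} {l : ℕ} {w : ι → HPlus →L[ℂ] HPlus} {y : HPlus →L[ℂ] HPlus}
    (hy : HasSum w y)
    (hc : ∀ n, ∃ r : ι → ℝ, Summable r ∧ ∀ N i, ‖(commNumber N ^ n) (w i)‖ ≤ r i)
    (hs : ∀ n, ∃ r : ι → ℝ, Summable r ∧
      ∀ N i, ‖(mulNumber N ^ n) (w i * U ^ l - U ^ l * w i)‖ ≤ r i) : IsSmooth l y := by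
  refine ⟨fun n => ?_, fun n => ?_⟩
  · obtain ⟨r, hr, h⟩ := hc n
    refine ⟨∑' i, r i, fun N => ?_⟩
    exact (hy.mapL (commNumber N ^ n)).norm_le_of_bounded hr.hasSum (h N)
  · obtain ⟨r, hr, h⟩ := hs n
    refine ⟨∑' i, r i, fun N => ?_⟩
    exact ((((hy.mul_right _).sub (hy.mul_left _))).mapL (mulNumber N ^ n)).norm_le_of_bounded
      hr.hasSum (h N)

/-- A sum of powers of finitely many smooth operators with rapidly decaying coefficients is
smooth. -/
theorem isSmooth_of_hasSum_pow {ι κ : Type*} [Finite κ] {l : ℕ} {x : κ → HPlus →L[ℂ] HPlus}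
    (hx : ∀ t, IsSmooth l (x t)) {ρ : ℝ} (hρ : 1 ≤ ρ) (hxρ : ∀ t, ‖x t‖ ≤ ρ) {c : ι → ℂ}
    (t : ι → κ) (k : ι → ℕ) (hc : ∀ n : ℕ, Summable fun i => ‖c i‖ * (1 + k i) ^ n * ρ ^ k i)
    {y : HPlus →L[ℂ] HPlus} (hy : HasSum (fun i => c i • x (t i) ^ k i) y) : IsSmooth l y := by
  have := Fintype.ofFinite κ
  refine isSmooth_of_hasSum hy (fun n => ?_) (fun n => ?_)
  · choose C hC0 hC using fun t => (hx t).exists_comm_pow_bound hρ (hxρ t) n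
    refine ⟨fun i => (∑ s, C s) * (‖c i‖ * (1 + k i) ^ (n + 1) * ρ ^ k i),
      (hc _).mul_left _, fun N i => ?_⟩
    rw [map_smul, norm_smul]
    calc _ ≤ ‖c i‖ * (C (t i) * (1 + k i) ^ (n + 1) * ρ ^ k i) := by gcongr; exact hC _ _ _
      _ ≤ ‖c i‖ * ((∑ s, C s) * (1 + k i) ^ (n + 1) * ρ ^ k i) := by
        gcongr
        exact Finset.single_le_sum (fun s _ => hC0 s) (Finset.mem_univ _)
      _ = _ := by ring
  · choose C hC0 hC using fun t => (hx t).exists_shift_pow_bound hρ (hxρ t) n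
    refine ⟨fun i => (∑ s, C s) * (‖c i‖ * (1 + k i) ^ (n + 1) * ρ ^ k i),
      (hc _).mul_left _, fun N i => ?_⟩
    rw [smul_mul_assoc, mul_smul_comm, ← smul_sub, map_smul, norm_smul]
    calc _ ≤ ‖c i‖ * (C (t i) * (1 + k i) ^ (n + 1) * ρ ^ k i) := by gcongr; exact hC _ _ _
      _ ≤ ‖c i‖ * ((∑ s, C s) * (1 + k i) ^ (n + 1) * ρ ^ k i) := by
        gcongr
        exact Finset.single_le_sum (fun s _ => hC0 s) (Finset.mem_univ _)
      _ = _ := by ring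

theorem IsSmooth.exp {l : ℕ} {x : HPlus →L[ℂ] HPlus} (h : IsSmooth l x) :
    IsSmooth l (NormedSpace.exp x) := by
  set ρ := max 1 ‖x‖
  refine isSmooth_of_hasSum_pow (κ := Unit) (fun _ => h) (le_max_left 1 ‖x‖)
    (fun _ => le_max_right _ _) (fun _ => ()) (fun m : ℕ => m) (fun n => ?_)
    (NormedSpace.exp_series_hasSum_exp' (𝕂 := ℂ) x)
  have hρ : 0 < ρ := by positivity
  have hs : Summable fun m : ℕ => (n.factorial * Real.exp 1) *
      ((Real.exp 1 * ρ) ^ m / m.factorial) :=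
    (Real.summable_pow_div_factorial _).mul_left _
  refine hs.of_nonneg_of_le (fun m => by positivity) fun m => ?_
  -- The polynomial factor is absorbed into an exponential, which the factorial outweighs.
  have h1 : (1 + m : ℝ) ^ n ≤ n.factorial * Real.exp (1 + m) := by
    have := Real.pow_div_factorial_le_exp (1 + m : ℝ) (by positivity) n
    rwa [div_le_iff₀' (by positivity)] at this
  rw [norm_inv, Complex.norm_natCast]
  calc _ ≤ (m.factorial : ℝ)⁻¹ * (n.factorial * Real.exp (1 + m)) * ρ ^ m := by gcongr
    _ = _ := by
      rw [Real.exp_add, mul_pow, ← Real.exp_nat_mul, mul_one]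
      ring

/-! ### Smoothness in terms of matrix entries -/

/-- Rapid decay of the matrix entries away from the diagonal. -/
def OffDiagonalDecay (x : HPlus →L[ℂ] HPlus) : Prop :=
  ∀ n : ℕ, ∃ C : ℝ, ∀ k j : ℕ, (1 + |(k : ℝ) - j|) ^ n * ‖entry k j x‖ ≤ C

/-- Rapid decay of a double sequence. -/
def RapidDecay (q : ℕ → ℕ → ℂ) : Prop :=
  ∀ n : ℕ, ∃ C : ℝ, ∀ k j : ℕ, (1 + (k : ℝ) + (j : ℝ)) ^ n * ‖q k j‖ ≤ C

theorem summable_inv_one_add_abs_sq : Summable fun n : ℤ => ((1 + |(n : ℝ)|) ^ 2)⁻¹ := by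
  have h : Summable fun n : ℤ => 1 / |(n : ℝ)| ^ 2 := by
    simpa using (Real.summable_one_div_int_pow (p := 2)).2 one_lt_two
  refine Summable.of_norm_bounded_eventually h ?_
  filter_upwards [(Set.finite_singleton (0 : ℤ)).compl_mem_cofinite] with n hn
  have hn : 0 < |(n : ℝ)| := by simpa using hn
  rw [Real.norm_of_nonneg (by positivity), one_div]
  gcongr
  linarith

/-- The Schur test for operators with quadratic off-diagonal decay. -/
theorem exists_opNorm_le_of_offDiagonal : ∃ S : ℝ, 0 ≤ S ∧ ∀ (x : HPlus →L[ℂ] HPlus) (C : ℝ),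
    (∀ k j : ℕ, (1 + |(k : ℝ) - j|) ^ 2 * ‖entry k j x‖ ≤ C) → ‖x‖ ≤ C * S := by
  refine ⟨∑' n : ℤ, ((1 + |(n : ℝ)|) ^ 2)⁻¹, tsum_nonneg fun n => by positivity,
    fun x C h => ?_⟩
  have hC : 0 ≤ C := le_trans (by positivity) (h 0 0)
  have hsum : ∀ (F : Finset ℕ) (g : ℕ → ℤ), Function.Injective g →
      ∑ j ∈ F, C * ((1 + |(g j : ℝ)|) ^ 2)⁻¹ ≤ C * ∑' n : ℤ, ((1 + |(n : ℝ)|) ^ 2)⁻¹ := by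
    intro F g hg
    rw [← Finset.mul_sum]
    gcongr
    rw [← Finset.sum_image (f := fun n : ℤ => ((1 + |(n : ℝ)|) ^ 2)⁻¹) (g := g) hg.injOn]
    exact summable_inv_one_add_abs_sq.sum_le_tsum _ fun n _ => by positivity
  refine opNorm_le_of_schur (ι := ℕ) (r := fun k j => C * ((1 + |(((k : ℤ) - (j : ℤ) : ℤ) : ℝ)|) ^ 2)⁻¹)
    (mul_nonneg hC (tsum_nonneg fun n => by positivity))
    (fun k F => hsum _ (fun j => (k : ℤ) - j) fun a b hab => by
      simp only at hab; omega)
    (fun j F => hsum _ (fun k => (k : ℤ) - j) fun a b hab => by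
      simp only at hab; omega)
    fun k j => ?_
  rw [← div_eq_mul_inv, le_div_iff₀' (by positivity)]
  push_cast
  exact h k j

theorem one_add_abs_sub_le (k j : ℕ) : 1 + |(k : ℝ) - j| ≤ 1 + k + j := by
  have : |(k : ℝ) - j| ≤ k + j := by
    rw [abs_le]
    constructor <;> linarith [k.cast_nonneg (α := ℝ), j.cast_nonneg (α := ℝ)]
  linarith

theorem norm_natCast_sub_natCast (k j : ℕ) : ‖(k : ℂ) - j‖ = |(k : ℝ) - j| := by
  rw [← Complex.ofReal_natCast, ← Complex.ofReal_natCast, ← Complex.ofReal_sub,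
    Complex.norm_real, Real.norm_eq_abs]

theorem IsSmooth.offDiagonalDecay {l : ℕ} {x : HPlus →L[ℂ] HPlus} (h : IsSmooth l x) :
    OffDiagonalDecay x := by
  intro n
  obtain ⟨C, hC⟩ := h.comm n
  refine ⟨2 ^ (n - 1) * (‖x‖ + C), fun k j => ?_⟩
  have h1 : |(k : ℝ) - j| ^ n * ‖entry k j x‖ ≤ C := by
    -- With `N = k + j` the truncation does not affect row `k` or column `j`.
    have := (norm_entry_le k j _).trans (hC (k + j))
    rw [entry_commNumber_pow, min_eq_left (by omega), min_eq_left (by omega), norm_mul,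
      norm_pow, norm_natCast_sub_natCast] at this
    exact this
  calc _ ≤ 2 ^ (n - 1) * (1 ^ n + |(k : ℝ) - j| ^ n) * ‖entry k j x‖ := by
        gcongr
        exact add_pow_le zero_le_one (abs_nonneg _) n
    _ = 2 ^ (n - 1) * (‖entry k j x‖ + |(k : ℝ) - j| ^ n * ‖entry k j x‖) := by ring
    _ ≤ _ := by
        gcongr
        exact norm_entry_le k j x

/-- Since `1 + k + j ≤ 2 (1 + k) (1 + |k - j|)`, and a product is at most a sum of squares, exponent
`2n` in both hypotheses gives exponent `n`. -/
theorem rapidDecay_of_row_of_offDiagonal {q : ℕ → ℕ → ℂ}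
    (h1 : ∀ n : ℕ, ∃ C : ℝ, ∀ k j : ℕ, (1 + (k : ℝ)) ^ n * ‖q k j‖ ≤ C)
    (h2 : ∀ n : ℕ, ∃ C : ℝ, ∀ k j : ℕ, (1 + |(k : ℝ) - j|) ^ n * ‖q k j‖ ≤ C) : RapidDecay q := by
  intro n
  obtain ⟨C₁, hC₁⟩ := h1 (n * 2)
  obtain ⟨C₂, hC₂⟩ := h2 (n * 2)
  refine ⟨2 ^ n * (C₁ + C₂), fun k j => ?_⟩
  set t := |(k : ℝ) - j| with ht
  have hj : (j : ℝ) ≤ k + t := by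
    have := neg_abs_le ((k : ℝ) - j)
    linarith
  have ht0 : 0 ≤ t := abs_nonneg _
  have hk0 : (0 : ℝ) ≤ k := k.cast_nonneg
  calc (1 + (k : ℝ) + j) ^ n * ‖q k j‖ ≤ (2 * ((1 + k) * (1 + t))) ^ n * ‖q k j‖ := by
        gcongr
        nlinarith
    _ = 2 ^ n * (((1 + k : ℝ) ^ n * (1 + t) ^ n) * ‖q k j‖) := by rw [mul_pow, mul_pow, mul_assoc]
    _ ≤ 2 ^ n * (((1 + k : ℝ) ^ (n * 2) + (1 + t) ^ (n * 2)) * ‖q k j‖) := by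
        gcongr
        rw [pow_mul, pow_mul]
        nlinarith [sq_nonneg ((1 + k : ℝ) ^ n - (1 + t) ^ n), sq_nonneg ((1 + k : ℝ) ^ n),
          sq_nonneg ((1 + t) ^ n)]
    _ ≤ _ := by
        rw [add_mul]
        gcongr
        · exact hC₁ k j
        · exact hC₂ k j

theorem IsSmooth.rapidDecay {l : ℕ} {x : HPlus →L[ℂ] HPlus} (h : IsSmooth l x) :
    RapidDecay fun k j => entry (k + l) (j + l) x - entry k j x := by
  refine rapidDecay_of_row_of_offDiagonal (fun n => ?_) (fun n => ?_)
  · obtain ⟨C, hC⟩ := h.shift n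
    refine ⟨C, fun k j => ?_⟩
    -- Row `k + l` of the commutator holds the difference in question at column `j`, and `N = k + l`
    -- makes the truncation harmless.
    have := (norm_entry_le (k + l) j _).trans (hC (k + l))
    rw [entry_mulNumber_pow, min_self, norm_mul, norm_pow, entry_commutator_U_pow,
      if_pos (by omega), Nat.add_sub_cancel] at this
    refine le_trans ?_ this
    gcongr
    have h1 : ‖(1 : ℂ) + ((k + l : ℕ) : ℂ)‖ = 1 + (k + l : ℕ) := by
      rw [← Nat.cast_one, ← Nat.cast_add, Complex.norm_natCast]; push_cast; ring
    rw [h1]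
    push_cast
    linarith [l.cast_nonneg (α := ℝ)]
  · obtain ⟨C, hC⟩ := h.offDiagonalDecay n
    refine ⟨C + C, fun k j => ?_⟩
    refine (mul_le_mul_of_nonneg_left (norm_sub_le _ _) (by positivity)).trans ?_
    rw [mul_add]
    refine add_le_add ?_ (hC k j)
    simpa using hC (k + l) (j + l)

/-- Two additional powers of decay pay for the Schur test, whose constant is the same for all `N`.
-/
theorem isSmooth_of_decay {l : ℕ} {x : HPlus →L[ℂ] HPlus} (h₁ : OffDiagonalDecay x)
    (h₂ : RapidDecay fun k j => entry (k + l) (j + l) x - entry k j x) : IsSmooth l x := by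
  obtain ⟨S, hS0, hS⟩ := exists_opNorm_le_of_offDiagonal
  refine ⟨fun n => ?_, fun n => ?_⟩
  · obtain ⟨C, hC⟩ := h₁ (n + 2)
    refine ⟨C * S, fun N => hS _ C fun k j => le_trans ?_ (hC k j)⟩
    rw [entry_commNumber_pow, norm_mul, norm_pow, pow_add, mul_comm ((1 + |(k : ℝ) - j|) ^ n),
      mul_assoc]
    gcongr
    rw [norm_natCast_sub_natCast]
    -- Truncation is 1-Lipschitz, which makes the bound uniform in `N`.
    have := abs_min_sub_min_le_max (k : ℝ) N j N
    push_cast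
    rw [sub_self, abs_zero, max_eq_left (abs_nonneg _)] at this
    linarith
  · have h3 : RapidDecay fun k j => entry k j (x * U ^ l - U ^ l * x) := by
      intro n
      obtain ⟨C₁, hC₁⟩ := h₁ n
      obtain ⟨C₂, hC₂⟩ := h₂ n
      have hC₁0 : 0 ≤ C₁ := le_trans (by positivity) (hC₁ 0 0)
      have hC₂0 : 0 ≤ C₂ := le_trans (by positivity) (hC₂ 0 0)
      refine ⟨(1 + l) ^ n * (C₁ + C₂), fun k j => ?_⟩
      have hl0 : (0 : ℝ) ≤ l := l.cast_nonneg
      have hj0 : (0 : ℝ) ≤ j := j.cast_nonneg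
      beta_reduce
      rw [entry_commutator_U_pow]
      split_ifs with hl
      · obtain ⟨i, rfl⟩ := Nat.exists_eq_add_of_le' hl
        have hi0 : (0 : ℝ) ≤ i := i.cast_nonneg
        rw [Nat.add_sub_cancel]
        calc _ ≤ ((1 + l) * (1 + (i : ℝ) + j)) ^ n
              * ‖entry (i + l) (j + l) x - entry i j x‖ := by
              gcongr
              push_cast
              nlinarith
          _ = (1 + l) ^ n * ((1 + (i : ℝ) + j) ^ n
              * ‖entry (i + l) (j + l) x - entry i j x‖) := by rw [mul_pow, mul_assoc]
          _ ≤ _ := by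
              gcongr
              linarith [hC₂ i j]
      -- In the rows `k < l` off-diagonal decay suffices: there `k` is bounded, so the distance to
      -- the diagonal controls `k + j`.
      · have hkl : (k : ℝ) ≤ l := by exact_mod_cast (not_le.1 hl).le
        rw [sub_zero]
        calc _ ≤ ((1 + l) * (1 + |(k : ℝ) - (j + l : ℕ)|)) ^ n * ‖entry k (j + l) x‖ := by
              gcongr
              push_cast
              have : (j : ℝ) + l - k ≤ |(k : ℝ) - (j + l)| := by
                rw [abs_sub_comm]; exact le_abs_self _
              nlinarith
          _ = (1 + l) ^ n * ((1 + |(k : ℝ) - (j + l : ℕ)|) ^ n * ‖entry k (j + l) x‖) := by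
              rw [mul_pow, mul_assoc]
          _ ≤ _ := by
              gcongr
              linarith [hC₁ k (j + l)]
    obtain ⟨C, hC⟩ := h3 (n + 2)
    refine ⟨C * S, fun N => hS _ C fun k j => le_trans ?_ (hC k j)⟩
    have hk0 : (0 : ℝ) ≤ k := k.cast_nonneg
    have hj0 : (0 : ℝ) ≤ j := j.cast_nonneg
    rw [entry_mulNumber_pow, norm_mul, norm_pow, pow_add, mul_comm ((1 + (k : ℝ) + j) ^ n),
      mul_assoc]
    gcongr ?_ ^ _ * (?_ ^ _ * _)
    · exact one_add_abs_sub_le k j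
    · rw [← Nat.cast_one, ← Nat.cast_add, Complex.norm_natCast]
      have : ((min k N : ℕ) : ℝ) ≤ k := by exact_mod_cast min_le_left k N
      push_cast at this ⊢
      linarith

/-! ### Matrix entries of smooth elements -/

theorem entry_T (b : H →L[ℂ] H) (k j : ℕ) : entry k j (T b) = entry (k : ℤ) (j : ℤ) b := by
  simp only [entry_apply, T, ContinuousLinearMap.comp_apply, s_E, PNonneg_apply]

theorem V_apply (n : ℤ) (z : H) (k : ℤ) : V n z k = z (k - n) := by
  refine (hasSum_entry_mul (V n) z k).unique ?_
  simp only [entry_apply, V_E, E_apply]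
  convert hasSum_single (k - n) fun j hj => ?_ using 1
  · simp
  · rw [if_neg (by omega), zero_mul]

theorem entry_V_mul_mul_V (n k j : ℤ) (b : H →L[ℂ] H) :
    entry k j (V n * b * V (-n)) = entry (k - n) (j - n) b := by
  simp only [entry_apply, mul_apply_eq_comp, V_E, V_apply, sub_eq_add_neg]

theorem entry_V_mul_m {S : Supernatural} (n k j : ℤ) (f : C(SAdic S, ℂ)) :
    entry k j (V n * m f) = if n = k - j then f j else 0 := by
  simp only [entry_apply, mul_apply_eq_comp, m, diagonal_E, map_smul, V_E, lp.coeFn_smul,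
    Pi.smul_apply, smul_eq_mul, E_apply, mul_ite, mul_one, mul_zero]
  congr 1
  rw [eq_iff_iff]
  omega

theorem entry_of_hasSum_V_mul_m {S : Supernatural} {f : ℤ → C(SAdic S, ℂ)} {b : H →L[ℂ] H}
    (h : HasSum (fun n : ℤ => V n * m (f n)) b) (k j : ℤ) : entry k j b = f (k - j) j := by
  refine (h.mapL (entry k j)).unique ?_
  simp only [entry_V_mul_m]
  convert hasSum_single (k - j) fun n hn => ?_ using 1
  · simp
  · rw [if_neg hn]

theorem entry_matrixUnit (k j p q : ℕ) :
    entry k j (matrixUnit p q) = if (p, q) = (k, j) then 1 else 0 := by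
  simp only [entry_apply, matrixUnit, InnerProductSpace.rankOne_apply, lp.coeFn_smul,
    Pi.smul_apply, smul_eq_mul, E_apply]
  simp only [E, lp.inner_single_left]
  simp [lp.single_apply, Pi.single_apply, Prod.ext_iff, eq_comm, ite_and]

theorem entry_of_hasSum_matrixUnit {q : ℕ → ℕ → ℂ} {c : HPlus →L[ℂ] HPlus}
    (h : HasSum (fun i : ℕ × ℕ => q i.1 i.2 • matrixUnit i.1 i.2) c) (k j : ℕ) :
    entry k j c = q k j := by
  refine (h.mapL (entry k j)).unique ?_
  simp only [map_smul, entry_matrixUnit]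
  convert hasSum_single (k, j) fun n hn => ?_ using 1
  · simp
  · simp [hn]

/-- The entries of `T b` are invariant under the step `(l, l)`, so only `c` contributes to the
differences; off the diagonal `‖f n‖` and `c` supply the decay. -/
theorem exists_isSmooth_of_mem_smoothBDT {S : Supernatural} {a : HPlus →L[ℂ] HPlus}
    (ha : a ∈ smoothBDT S) : ∃ l : ℕ, Supernatural.Divides l S ∧ IsSmooth l a := by
  obtain ⟨-, b, ⟨-, ⟨f, hf, hb⟩, l, hl, hbl⟩, c, ⟨q, hq, hc⟩, rfl⟩ := ha
  refine ⟨l, hl, isSmooth_of_decay (fun n => ?_) (fun n => ?_)⟩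
  · obtain ⟨C₁, hC₁⟩ := hf n
    obtain ⟨C₂, hC₂⟩ := hq n
    refine ⟨C₁ + C₂, fun k j => ?_⟩
    rw [map_add, entry_T, entry_of_hasSum_V_mul_m hb, entry_of_hasSum_matrixUnit hc]
    refine (mul_le_mul_of_nonneg_left (norm_add_le _ _) (by positivity)).trans ?_
    rw [mul_add]
    refine add_le_add (le_trans ?_ (hC₁ (k - j))) (le_trans ?_ (hC₂ k j))
    · push_cast
      gcongr
      exact (f _).norm_coe_le_norm _
    · gcongr ?_ ^ _ * _
      exact one_add_abs_sub_le k j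
  · obtain ⟨C, hC⟩ := hq n
    refine ⟨C + C, fun k j => ?_⟩
    have h1 : entry (k + l) (j + l) (T b) = entry k j (T b) := by
      rw [entry_T, entry_T]
      nth_rw 1 [← hbl]
      rw [entry_V_mul_mul_V]
      simp
    simp only [map_add, h1, add_sub_add_left_eq_sub, entry_of_hasSum_matrixUnit hc]
    refine (mul_le_mul_of_nonneg_left (norm_sub_le _ _) (by positivity)).trans ?_
    rw [mul_add]
    refine add_le_add (le_trans ?_ (hC (k + l) (j + l))) (hC k j)
    push_cast
    gcongr <;> linarith [l.cast_nonneg (α := ℝ)]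

/-! ### Residue classes in the `S`-adic ring -/

/-- The residue class is the trace on `ℤ` of a clopen set: an ultrametric ball of radius `p ^ (-e)`
when `ε = ∞`, and any subset of a discrete space otherwise, where `e ≤ n` makes the class well
defined modulo `p ^ n`. -/
theorem exists_continuous_primePow_dvd (p : Nat.Primes) (ε : ℕ∞) (e : ℕ) (h : (e : ℕ∞) ≤ ε)
    (r : ℤ) : ∃ χ : C(PrimaryFactor p ε, ℂ), ∀ k : ℤ,
      χ (k : PrimaryFactor p ε) = if ((p : ℕ) ^ e : ℤ) ∣ k - r then 1 else 0 := by
  suffices H : ∃ A : Set (PrimaryFactor p ε), IsClopen A ∧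
      ∀ k : ℤ, (k : PrimaryFactor p ε) ∈ A ↔ ((p : ℕ) ^ e : ℤ) ∣ k - r by
    classical
    obtain ⟨A, hA, hk⟩ := H
    refine ⟨(LocallyConstant.charFn ℂ hA : C(PrimaryFactor p ε, ℂ)), fun k => ?_⟩
    simp only [LocallyConstant.coe_continuousMap, LocallyConstant.coe_charFn, Set.indicator_apply,
      hk, Pi.one_apply]
  match ε, h with
  | none, _ =>
    have hp : ((p : ℕ) : ℝ) ^ (-e : ℤ) ≠ 0 := zpow_ne_zero _ (by exact_mod_cast p.2.ne_zero)
    refine ⟨@Metric.closedBall ℤ_[(p : ℕ)] _ (r : ℤ_[(p : ℕ)]) ((p : ℝ) ^ (-e : ℤ)),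
      IsUltrametricDist.isClopen_closedBall (X := ℤ_[(p : ℕ)]) _ hp, fun k => ?_⟩
    change (k : ℤ_[(p : ℕ)]) ∈ Metric.closedBall (r : ℤ_[(p : ℕ)]) _ ↔ _
    rw [mem_closedBall_iff_norm, ← Int.cast_sub, PadicInt.norm_int_le_pow_iff_dvd]
  | some n, h =>
    have h : e ≤ n := ENat.natCast_le_natCast.1 h
    refine ⟨({x | ∃ k : ℤ, ((p : ℕ) ^ e : ℤ) ∣ k - r ∧ x = (k : ZMod ((p : ℕ) ^ n))} :
      Set (ZMod ((p : ℕ) ^ n))), isClopen_discrete (X := ZMod ((p : ℕ) ^ n)) _, fun k => ?_⟩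
    change (k : ZMod ((p : ℕ) ^ n)) ∈ {x : ZMod ((p : ℕ) ^ n) | _} ↔ _
    refine ⟨fun ⟨i, hi, hki⟩ => ?_, fun hk => ⟨k, hk, rfl⟩⟩
    rw [eq_comm, ZMod.intCast_eq_intCast_iff_dvd_sub] at hki
    push_cast at hki
    have := (pow_dvd_pow ((p : ℕ) : ℤ) h).trans hki
    simpa using dvd_add this hi

theorem Supernatural.Divides.of_dvd {S : Supernatural} {a b : ℕ} (h : Supernatural.Divides b S)
    (hab : a ∣ b) : Supernatural.Divides a S := by
  have ha : 0 < a := Nat.pos_of_dvd_of_pos hab h.1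
  refine ⟨ha, fun p => le_trans ?_ (h.2 p)⟩
  exact_mod_cast (Nat.factorization_le_iff_dvd ha.ne' h.1.ne').2 hab p

/-- The indicator function of a residue class modulo a divisor of `S` is continuous. -/
theorem exists_continuous_dvd_sub {S : Supernatural} {l : ℕ} (hl : Supernatural.Divides l S)
    (r : ℤ) : ∃ χ : C(SAdic S, ℂ), ∀ k : ℤ,
      χ (k : SAdic S) = if (l : ℤ) ∣ k - r then 1 else 0 := by
  induction l using Nat.recOnPosPrimePosCoprime with
  | prime_pow p n hp hn =>
    let P : Nat.Primes := ⟨p, hp⟩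
    have h := hl.2 P
    rw [hp.factorization_pow, Finsupp.single_eq_same] at h
    obtain ⟨χ, hχ⟩ := exists_continuous_primePow_dvd P (S P) n h r
    refine ⟨χ.comp ⟨fun x => x P, continuous_apply P⟩, fun k => ?_⟩
    simpa using hχ k
  | zero => exact absurd hl.1 (lt_irrefl 0)
  | one => exact ⟨1, by simp⟩
  | coprime a b _ _ hab iha ihb =>
    obtain ⟨χ, hχ⟩ := iha (hl.of_dvd (dvd_mul_right a b))
    obtain ⟨ψ, hψ⟩ := ihb (hl.of_dvd (dvd_mul_left b a))
    refine ⟨χ * ψ, fun k => ?_⟩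
    rw [ContinuousMap.mul_apply, hχ, hψ]
    -- For coprime moduli the indicator functions multiply.
    have : ((a * b : ℕ) : ℤ) ∣ k - r ↔ (a : ℤ) ∣ k - r ∧ (b : ℤ) ∣ k - r := by
      push_cast
      exact ⟨fun h => ⟨(dvd_mul_right _ _).trans h, (dvd_mul_left _ _).trans h⟩,
        fun h => (Nat.isCoprime_iff_coprime.2 hab).mul_dvd h.1 h.2⟩
    simp only [this, ite_and]
    split_ifs <;> simp

/-- Every family of `l`-periodic functions on `ℤ`, where `l` divides `S`, comes from a family of
continuous functions on the `S`-adic ring with a norm bound. -/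
theorem exists_continuous_extension {S : Supernatural} {l : ℕ} (hl : Supernatural.Divides l S) :
    ∃ (K : ℝ), 0 ≤ K ∧ ∀ g : ℕ → ℂ, ∃ f : C(SAdic S, ℂ),
      (∀ k : ℤ, f (k : SAdic S) = g (k % l).toNat) ∧
      ∀ C : ℝ, (∀ r, ‖g r‖ ≤ C) → ‖f‖ ≤ C * K := by
  choose χ hχ using fun r : ℕ => exists_continuous_dvd_sub hl (r : ℤ)
  have hl0 : (0 : ℤ) < l := by exact_mod_cast hl.1
  refine ⟨∑ r ∈ Finset.range l, ‖χ r‖, by positivity, fun g =>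
    ⟨∑ r ∈ Finset.range l, g r • χ r, fun k => ?_, fun C hg => ?_⟩⟩
  · have hmod := Int.emod_nonneg k hl0.ne'
    have hlt := Int.emod_lt_of_pos k hl0
    have hdiv := Int.emod_add_mul_ediv k l
    rw [ContinuousMap.sum_apply, Finset.sum_eq_single (k % l).toNat]
    · rw [ContinuousMap.smul_apply, hχ, if_pos, smul_eq_mul, mul_one]
      exact ⟨k / l, by omega⟩
    · intro r hr hne
      rw [Finset.mem_range] at hr
      rw [ContinuousMap.smul_apply, hχ, if_neg, smul_zero]
      intro hd
      have h1 : k % l = (r : ℤ) % l :=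
        Int.emod_eq_emod_iff_emod_sub_eq_zero.2 (Int.emod_eq_zero_of_dvd hd)
      rw [Int.emod_eq_of_lt (a := (r : ℤ)) (by omega) (by omega)] at h1
      omega
    · intro h
      exact absurd (Finset.mem_range.2 (by omega)) h
  · rw [Finset.mul_sum]
    refine (norm_sum_le _ _).trans (Finset.sum_le_sum fun r _ => ?_)
    rw [norm_smul]
    gcongr
    exact hg r

/-! ### The generators of the Bunce-Deddens algebra -/

theorem star_V_one : star (V 1) = V (-1) := by
  have h : star (V 1) * V 1 = 1 :=
    (V 1).norm_map_iff_adjoint_comp_self.1 (LinearIsometry.norm_map _)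
  calc star (V 1) = star (V 1) * (V 1 * V (-1)) := by rw [V_mul]; simp [V_zero]
    _ = V (-1) := by rw [← mul_assoc, h, one_mul]

theorem V_mem_BD (S : Supernatural) (n : ℤ) : V n ∈ BD S := by
  have h1 : V 1 ∈ BD S :=
    StarSubalgebra.le_topologicalClosure _ (StarAlgebra.subset_adjoin ℂ _ (Set.mem_insert _ _))
  have h2 : V (-1) ∈ BD S := star_V_one ▸ star_mem h1
  induction n with
  | zero => rw [V_zero]; exact one_mem _
  | succ n ih => rw [← V_mul]; exact mul_mem ih h1
  | pred n ih => rw [sub_eq_add_neg, ← V_mul]; exact mul_mem ih h2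

theorem m_mem_BD {S : Supernatural} (f : C(SAdic S, ℂ)) : m f ∈ BD S :=
  StarSubalgebra.le_topologicalClosure _
    (StarAlgebra.subset_adjoin ℂ _ (Set.mem_insert_of_mem _ ⟨f, rfl⟩))

theorem norm_V_mul_m_le {S : Supernatural} (n : ℤ) (f : C(SAdic S, ℂ)) : ‖V n * m f‖ ≤ ‖f‖ := by
  refine (norm_mul_le _ _).trans ?_
  have h1 : ‖V n‖ ≤ 1 := LinearIsometry.norm_toContinuousLinearMap_le _
  have h2 : ‖m f‖ ≤ ‖f‖ := lp.norm_mapCLM_le _ _ (norm_nonneg f)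
    (fun _ => (ContinuousLinearMap.opNorm_lsmul_apply_le _).trans (f.norm_coe_le_norm _))
  exact (mul_le_of_le_one_left (norm_nonneg _) h1).trans h2

theorem mem_BD_of_hasSum {S : Supernatural} {f : ℤ → C(SAdic S, ℂ)} {b : H →L[ℂ] H}
    (h : HasSum (fun n : ℤ => V n * m (f n)) b) : b ∈ BD S :=
  (StarSubalgebra.isClosed_topologicalClosure _).mem_of_tendsto h
    (Filter.Eventually.of_forall fun _ =>
      sum_mem fun n _ => mul_mem (V_mem_BD S n) (m_mem_BD (f n)))

/-! ### Smooth compact operators -/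

theorem summable_inv_one_add_nat_sq : Summable fun n : ℕ => ((1 + (n : ℝ)) ^ 2)⁻¹ := by
  simpa [Function.comp_def] using
    summable_inv_one_add_abs_sq.comp_injective (Nat.cast_injective (R := ℤ))

theorem RapidDecay.exists_hasSum {q : ℕ → ℕ → ℂ} (hq : RapidDecay q) :
    ∃ c, HasSum (fun i : ℕ × ℕ => q i.1 i.2 • matrixUnit i.1 i.2) c := by
  obtain ⟨C, hC⟩ := hq 4
  have hs := summable_inv_one_add_nat_sq
  have hs2 := (hs.mul_of_nonneg hs (fun n => by positivity) (fun n => by positivity)).mul_left C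
  refine ⟨_, (Summable.of_norm_bounded hs2 fun i => ?_).hasSum⟩
  rw [norm_smul, matrixUnit, InnerProductSpace.norm_rankOne, norm_E, norm_E, mul_one, mul_one,
    ← mul_inv, ← div_eq_mul_inv, le_div_iff₀' (by positivity)]
  refine le_trans ?_ (hC i.1 i.2)
  gcongr
  have h1 : (0 : ℝ) ≤ i.1 := Nat.cast_nonneg _
  have h2 : (0 : ℝ) ≤ i.2 := Nat.cast_nonneg _
  calc ((1 + (i.1 : ℝ)) ^ 2 * (1 + (i.2 : ℝ)) ^ 2)
      ≤ (1 + (i.1 : ℝ) + i.2) ^ 2 * (1 + (i.1 : ℝ) + i.2) ^ 2 := by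
        gcongr ?_ ^ 2 * ?_ ^ 2 <;> linarith
    _ = _ := by ring

theorem mem_smoothCompact_of_rapidDecay {c : HPlus →L[ℂ] HPlus} {q : ℕ → ℕ → ℂ}
    (h : RapidDecay q) (hq : ∀ k j, entry k j c = q k j) : c ∈ smoothCompact := by
  obtain ⟨c', hc'⟩ := h.exists_hasSum
  have hcc : c' = c := entry_ext fun k j => (entry_of_hasSum_matrixUnit hc' k j).trans (hq k j).symm
  rw [hcc] at hc'
  exact ⟨q, h, hc'⟩

/-! ### Decomposition of smooth operators -/

/-- The sum of a double sequence along a ray of slope one with step `l`. -/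
def raySum (l : ℕ) (q : ℕ → ℕ → ℂ) (k j : ℕ) : ℂ := ∑' m : ℕ, q (k + m * l) (j + m * l)

/-- Of the exponent `n + 2`, the part `n` stays with `1 + k + j`, and `2` makes the sum over the ray
converge, as `m ≤ m l`. -/
theorem RapidDecay.exists_ray_bound {q : ℕ → ℕ → ℂ} (hq : RapidDecay q) {l : ℕ} (hl : 0 < l)
    (n : ℕ) : ∃ C : ℝ, ∀ k j m : ℕ, ‖q (k + m * l) (j + m * l)‖
      ≤ C * ((1 + (k : ℝ) + j) ^ n)⁻¹ * ((1 + (m : ℝ)) ^ 2)⁻¹ := by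
  obtain ⟨C, hC⟩ := hq (n + 2)
  refine ⟨C, fun k j m => ?_⟩
  rw [mul_assoc, ← mul_inv, ← div_eq_mul_inv, le_div_iff₀' (by positivity)]
  refine le_trans ?_ (hC (k + m * l) (j + m * l))
  have hml : (m : ℝ) ≤ (m * l : ℕ) := by exact_mod_cast Nat.le_mul_of_pos_right m hl
  have hk : (0 : ℝ) ≤ k := k.cast_nonneg
  have hj : (0 : ℝ) ≤ j := j.cast_nonneg
  have hm : (0 : ℝ) ≤ m := m.cast_nonneg
  rw [pow_add]
  gcongr ?_ ^ _ * ?_ ^ _ * _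
  · push_cast at hml ⊢; linarith
  · push_cast at hml ⊢; linarith

theorem RapidDecay.summable_ray {q : ℕ → ℕ → ℂ} (hq : RapidDecay q) {l : ℕ} (hl : 0 < l)
    (k j : ℕ) : Summable fun m : ℕ => q (k + m * l) (j + m * l) := by
  obtain ⟨C, hC⟩ := hq.exists_ray_bound hl 0
  exact (summable_inv_one_add_nat_sq.mul_left _).of_norm_bounded (hC k j)

theorem RapidDecay.raySum {q : ℕ → ℕ → ℂ} (hq : RapidDecay q) {l : ℕ} (hl : 0 < l) :
    RapidDecay (raySum l q) := by
  intro n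
  obtain ⟨C, hC⟩ := hq.exists_ray_bound hl n
  refine ⟨C * ∑' m : ℕ, ((1 + (m : ℝ)) ^ 2)⁻¹, fun k j => ?_⟩
  have h := tsum_of_norm_bounded (summable_inv_one_add_nat_sq.hasSum.mul_left _) (hC k j)
  calc _ ≤ (1 + (k : ℝ) + j) ^ n *
        (C * ((1 + (k : ℝ) + j) ^ n)⁻¹ * ∑' m : ℕ, ((1 + (m : ℝ)) ^ 2)⁻¹) := by
        gcongr
        exact h
    _ = _ := by field_simp

theorem RapidDecay.raySum_eq {q : ℕ → ℕ → ℂ} (hq : RapidDecay q) {l : ℕ} (hl : 0 < l)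
    (k j : ℕ) : BunceDeddens.raySum l q k j = q k j + BunceDeddens.raySum l q (k + l) (j + l) := by
  rw [BunceDeddens.raySum, (hq.summable_ray hl k j).tsum_eq_zero_add]
  simp only [zero_mul, add_zero, BunceDeddens.raySum]
  congr 2
  ext m
  congr 1 <;> ring

/-- The two positions lie on one diagonal and are joined by steps `(l, l)`. -/
theorem eq_of_periodic_of_dvd_sub {β : ℕ → ℕ → ℂ} {l : ℕ}
    (h : ∀ k j, β (k + l) (j + l) = β k j) {k j k' j' : ℕ} (h1 : (k : ℤ) - j = k' - j')
    (h2 : (l : ℤ) ∣ j - j') : β k j = β k' j' := by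
  have hmul : ∀ t k j : ℕ, β (k + l * t) (j + l * t) = β k j := by
    intro t
    induction t with
    | zero => simp
    | succ t ih =>
      intro k j
      rw [mul_add, mul_one, ← add_assoc, ← add_assoc, h, ih]
  wlog hjj : j' ≤ j generalizing k j k' j'
  · exact (this h1.symm ((dvd_sub_comm).1 h2) (by omega)).symm
  obtain ⟨t, ht⟩ := h2
  have hl0 : (0 : ℤ) ≤ l := by omega
  rcases hl0.eq_or_lt with hl | hl
  · rw [← hl, zero_mul] at ht
    obtain rfl : j = j' := by omega
    obtain rfl : k = k' := by omega
    rfl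
  · have ht0 : 0 ≤ t := by
      by_contra hneg
      nlinarith
    lift t to ℕ using ht0
    have ht' : (j : ℤ) = (j' + l * t : ℕ) := by push_cast; linarith
    have hk' : (k : ℤ) = (k' + l * t : ℕ) := by push_cast; linarith
    obtain rfl : j = j' + l * t := by exact_mod_cast ht'
    obtain rfl : k = k' + l * t := by exact_mod_cast hk'
    exact hmul t k' j'

/-- Adding to an entry of `y` all later differences along its ray gives, by telescoping, the limit
`β k j` of the entries `(k + ml, j + ml)`. This limit is `l`-periodic along diagonals, hence is the
matrix of `T b` for an `l`-periodic `b`; the remainder `y - T b` has the rapidly decaying entries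
`-raySum l q k j`. -/
theorem IsSmooth.mem_smoothBDT {S : Supernatural} {l : ℕ} (hl : Supernatural.Divides l S)
    {y : HPlus →L[ℂ] HPlus} (hy : IsSmooth l y) (hyS : y ∈ BDT S) : y ∈ smoothBDT S := by
  set q : ℕ → ℕ → ℂ := fun k j => entry (k + l) (j + l) y - entry k j y with hq
  have hqd : RapidDecay q := hy.rapidDecay
  set β : ℕ → ℕ → ℂ := fun k j => entry k j y + raySum l q k j with hβ
  have hper : ∀ k j, β (k + l) (j + l) = β k j := fun k j => by
    simp only [hβ]
    rw [hqd.raySum_eq hl.1 k j]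
    simp only [hq]
    ring
  have hdecay : ∀ n : ℕ, ∃ C : ℝ, ∀ k j : ℕ, (1 + |(k : ℝ) - j|) ^ n * ‖β k j‖ ≤ C := fun n => by
    obtain ⟨C₁, hC₁⟩ := hy.offDiagonalDecay n
    obtain ⟨C₂, hC₂⟩ := hqd.raySum hl.1 n
    refine ⟨C₁ + C₂, fun k j => ?_⟩
    refine (mul_le_mul_of_nonneg_left (norm_add_le _ _) (by positivity)).trans ?_
    rw [mul_add]
    refine add_le_add (hC₁ k j) (le_trans ?_ (hC₂ k j))
    gcongr ?_ ^ _ * _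
    exact one_add_abs_sub_le k j
  -- The value of `β` on the `n`-th diagonal at column `r`, moved by `|n|` periods so that the row
  -- `n + r + |n| l` is nonnegative and `toNat` loses nothing.
  set g : ℤ → ℕ → ℂ := fun n r => β (n + r + (n.natAbs * l : ℕ)).toNat (r + n.natAbs * l) with hg
  have hK : ∀ (n : ℤ) (r : ℕ), ((n + r + (n.natAbs * l : ℕ)).toNat : ℤ)
      = n + r + (n.natAbs * l : ℕ) := fun n r => by
    have := Nat.le_mul_of_pos_right n.natAbs hl.1
    omega
  have hgdecay : ∀ N : ℕ, ∃ C : ℝ, ∀ (n : ℤ) (r : ℕ), (1 + |(n : ℝ)|) ^ N * ‖g n r‖ ≤ C := by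
    intro N
    obtain ⟨C, hC⟩ := hdecay N
    refine ⟨C, fun n r => ?_⟩
    convert hC (n + r + (n.natAbs * l : ℕ)).toNat (r + n.natAbs * l) using 5
    have := congrArg (Int.cast : ℤ → ℝ) (hK n r)
    rw [Int.cast_natCast] at this
    rw [this]
    simp only [Int.cast_add, Int.cast_natCast, Nat.cast_add]
    ring
  obtain ⟨K, hK0, hext⟩ := exists_continuous_extension hl
  choose f hf hfn using fun n => hext (g n)
  have hfdecay : ∀ N : ℕ, ∃ C : ℝ, ∀ n : ℤ, (1 + |(n : ℝ)|) ^ N * ‖f n‖ ≤ C := by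
    intro N
    obtain ⟨C, hC⟩ := hgdecay N
    refine ⟨C * K, fun n => ?_⟩
    have h1 := hfn n (C / (1 + |(n : ℝ)|) ^ N) fun r => by
      rw [le_div_iff₀' (by positivity)]
      exact hC n r
    calc _ ≤ (1 + |(n : ℝ)|) ^ N * (C / (1 + |(n : ℝ)|) ^ N * K) := by gcongr
      _ = C * K := by field_simp
  have hsum : Summable fun n : ℤ => V n * m (f n) := by
    obtain ⟨C, hC⟩ := hfdecay 2
    refine (summable_inv_one_add_abs_sq.mul_left C).of_norm_bounded fun n => ?_
    refine (norm_V_mul_m_le n (f n)).trans ?_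
    rw [← div_eq_mul_inv, le_div_iff₀' (by positivity)]
    exact hC n
  set b := ∑' n : ℤ, V n * m (f n) with hb
  have hbsum : HasSum (fun n : ℤ => V n * m (f n)) b := hsum.hasSum
  have hbentry : ∀ k j : ℕ, entry (k : ℤ) (j : ℤ) b = β k j := fun k j => by
    rw [entry_of_hasSum_V_mul_m hbsum, hf]
    refine eq_of_periodic_of_dvd_sub hper ?_ ?_
    · rw [hK, Nat.cast_add]; ring
    · have h0 : (0 : ℤ) < l := by exact_mod_cast hl.1
      have h1 := Int.emod_nonneg (j : ℤ) h0.ne'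
      have h2 := Int.emod_add_mul_ediv (j : ℤ) l
      refine ⟨((k : ℤ) - j).natAbs - (j : ℤ) / l, ?_⟩
      rw [Nat.cast_add, Nat.cast_mul, Int.toNat_of_nonneg h1, mul_sub]
      linarith
  have hbmem : b ∈ smoothBD S := by
    refine ⟨mem_BD_of_hasSum hbsum, ⟨f, hfdecay, hbsum⟩, l, hl, entry_ext fun k j => ?_⟩
    rw [entry_V_mul_mul_V, entry_of_hasSum_V_mul_m hbsum, entry_of_hasSum_V_mul_m hbsum, hf, hf,
      sub_sub_sub_cancel_right, Int.sub_emod_right]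
  refine ⟨hyS, b, hbmem, y - T b, mem_smoothCompact_of_rapidDecay (q := fun k j => -raySum l q k j)
    (fun n => ?_) (fun k j => ?_), by abel⟩
  · simpa using hqd.raySum hl.1 n
  · rw [map_sub, entry_T, hbentry]
    simp only [hβ]
    ring

/-! ### Fourier expansion of smooth functions on compact sets -/

/-- Multiplication by a smooth cutoff that is `1` on `K` and vanishes off a compact `L ⊆ W`; outside
`L` the values of `f` do not matter. -/
theorem exists_contDiff_hasCompactSupport_eqOn {K W : Set ℝ} (hK : IsCompact K) (hW : IsOpen W)
    (hKW : K ⊆ W) {f : ℝ → ℂ} (hf : ContDiffOn ℝ ∞ f W) :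
    ∃ g : ℝ → ℂ, ContDiff ℝ ∞ g ∧ HasCompactSupport g ∧ Set.EqOn g f K := by
  obtain ⟨L, hL, hKL, hLW⟩ := exists_compact_between hK hW hKW
  obtain ⟨χ, hχ, -, hsupp, hone⟩ := exists_contMDiff_support_eq_eq_one_iff
    (modelWithCornersSelf ℝ ℝ) (n := ⊤) isOpen_interior hK.isClosed hKL
  have hsub : Function.support (fun x => χ x • f x) ⊆ L := fun x hx => by
    refine interior_subset (hsupp ▸ ?_ : x ∈ interior L)
    intro h0
    exact hx (by simp [h0])
  refine ⟨fun x => χ x • f x, contDiff_iff_contDiffAt.2 fun x => ?_,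
    HasCompactSupport.of_support_subset_isCompact hL hsub, fun x hx => ?_⟩
  · by_cases hxL : x ∈ L
    swap
    · refine contDiffAt_const (c := (0 : ℂ)) |>.congr_of_eventuallyEq ?_
      filter_upwards [hL.isClosed.isOpen_compl.mem_nhds hxL] with y hy
      by_contra h0
      exact hy (hsub h0)
    exact (contMDiff_iff_contDiff.1 hχ).contDiffAt.smul
      ((hf x (hLW hxL)).contDiffAt (hW.mem_nhds (hLW hxL)))
  · simp [(hone x).1 hx]

theorem summable_fourier_coefficients (h : SchwartzMap ℝ ℂ) (k : ℕ) :
    Summable fun n : ℤ => ‖(FourierTransform.fourier h) (n : ℝ)‖ * (1 + |(n : ℝ)|) ^ k := by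
  obtain ⟨C₁, -, hC₁⟩ := (FourierTransform.fourier h).decay 0 0
  obtain ⟨C₂, -, hC₂⟩ := (FourierTransform.fourier h).decay (k + 2) 0
  simp only [norm_iteratedFDeriv_zero, pow_zero, one_mul, Real.norm_eq_abs] at hC₁ hC₂
  refine (summable_inv_one_add_abs_sq.mul_left (2 ^ (k + 2 - 1) * (C₁ + C₂))).of_nonneg_of_le
    (fun n => by positivity) fun n => ?_
  rw [← div_eq_mul_inv, le_div_iff₀ (by positivity), mul_assoc, ← pow_add]
  calc _ ≤ ‖(FourierTransform.fourier h) (n : ℝ)‖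
        * (2 ^ (k + 2 - 1) * (1 ^ (k + 2) + |(n : ℝ)| ^ (k + 2))) := by
        gcongr
        exact add_pow_le zero_le_one (abs_nonneg _) _
    _ = 2 ^ (k + 2 - 1) * (‖(FourierTransform.fourier h) (n : ℝ)‖
        + |(n : ℝ)| ^ (k + 2) * ‖(FourierTransform.fourier h) (n : ℝ)‖) := by ring
    _ ≤ _ := by
        gcongr
        · exact hC₁ _
        · exact hC₂ _

/-- A smooth function near a compact set is there the sum of a Fourier series with rapidly decaying
coefficients. -/
theorem exists_fourier_expansion {K W : Set ℝ} (hK : IsCompact K) (hW : IsOpen W)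
    (hKW : K ⊆ W) {f : ℝ → ℂ} (hf : ContDiffOn ℝ ∞ f W) :
    ∃ (c : ℤ → ℂ) (θ : ℝ), (∀ k : ℕ, Summable fun n : ℤ => ‖c n‖ * (1 + |(n : ℝ)|) ^ k) ∧
      ∀ x ∈ K, f x = ∑' n : ℤ, c n * Complex.exp (n * (θ * Complex.I * x)) := by
  obtain ⟨g, hg, hgc, hgf⟩ := exists_contDiff_hasCompactSupport_eqOn hK hW hKW hf
  -- The period `2R` is large enough that no nonzero translate `x + 2Rn` of a point `x ∈ K` meets
  -- the support of `g`.
  obtain ⟨R, hR⟩ := (hgc.isCompact.union hK).isBounded.exists_pos_norm_lt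
  obtain ⟨hR0, hR⟩ := hR
  have hT : 2 * R ≠ 0 := by positivity
  have hhc : HasCompactSupport fun y : ℝ => g ((2 * R) • y) := hgc.comp_smul hT
  set h : SchwartzMap ℝ ℂ := hhc.toSchwartzMap (hg.comp (contDiff_const_smul _)) with hh
  have happ : ∀ y, h y = g (2 * R * y) := fun y => rfl
  refine ⟨fun n => (FourierTransform.fourier h) (n : ℝ), 2 * Real.pi / (2 * R),
    summable_fourier_coefficients h, fun x hx => ?_⟩
  -- Poisson summation for `h y = g (2R y)`; on the left only the term `n = 0` survives.
  have hp := h.tsum_eq_tsum_fourier (x / (2 * R))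
  rw [tsum_eq_single 0] at hp
  · rw [happ, Int.cast_zero, add_zero, mul_div_cancel₀ _ hT, hgf hx] at hp
    rw [hp]
    refine tsum_congr fun n => ?_
    rw [fourier_coe_apply]
    congr 2
    push_cast
    field_simp
  · intro n hn
    rw [happ]
    by_contra hne
    have h1 := hR _ (Or.inl (subset_tsupport g hne))
    have h2 := hR x (Or.inr hx)
    rw [mul_add, mul_div_cancel₀ _ hT, Real.norm_eq_abs] at h1
    rw [Real.norm_eq_abs] at h2
    have h3 : (1 : ℝ) ≤ |(n : ℝ)| := by exact_mod_cast Int.one_le_abs hn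
    have h4 : |2 * R * (n : ℝ)| ≤ |x + 2 * R * n| + |x| := by
      have := abs_sub (x + 2 * R * n) x
      rwa [add_sub_cancel_left] at this
    rw [abs_mul, abs_of_pos (by positivity : 0 < 2 * R)] at h4
    nlinarith

/-! ### The functional calculus -/

theorem cfc_exp_eq {a : HPlus →L[ℂ] HPlus} (ha : IsSelfAdjoint a) (z : ℂ) :
    cfc (fun w : ℂ => Complex.exp (z * w)) a = NormedSpace.exp (z • a) := by
  have hn : IsStarNormal a := ha.isStarNormal
  have hz : IsStarNormal (z • a) := inferInstance
  rw [← CFC.complex_exp_eq_normedSpace_exp hz, ← cfc_comp_smul z Complex.exp a]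
  rfl

theorem mem_spectrum_real_iff (a : HPlus →L[ℂ] HPlus) (x : ℝ) :
    x ∈ spectrum ℝ a ↔ (x : ℂ) ∈ spectrum ℂ a := by
  have : algebraMap ℝ (HPlus →L[ℂ] HPlus) x = algebraMap ℂ (HPlus →L[ℂ] HPlus) x := by
    rw [Algebra.algebraMap_eq_smul_one, Algebra.algebraMap_eq_smul_one]
    ext v i
    exact Complex.real_smul
  rw [spectrum.mem_iff, spectrum.mem_iff, this]

theorem IsSmooth.cfc {l : ℕ} {a : HPlus →L[ℂ] HPlus} (h : IsSmooth l a) (ha : IsSelfAdjoint a)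
    {W : Set ℝ} (hW : IsOpen W) (haW : spectrum ℝ a ⊆ W) {f : ℝ → ℂ} (hf : ContDiffOn ℝ ∞ f W) :
    IsSmooth l (cfc (fun z : ℂ => f z.re) a) := by
  have hn : IsStarNormal a := ha.isStarNormal
  have hre : ∀ w ∈ spectrum ℂ a, ((w.re : ℝ) : ℂ) = w :=
    fun w hw => (ha.mem_spectrum_eq_re hw).symm
  obtain ⟨c, θ, hc, hsum⟩ := exists_fourier_expansion
    ((spectrum.isCompact a).image Complex.continuous_re) hW (by
      rintro _ ⟨w, hw, rfl⟩
      exact haW ((mem_spectrum_real_iff a _).2 ((hre w hw).symm ▸ hw))) hf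
  -- Only natural powers are available, so `e^{inθa}` is written as the `|n|`-th power of `e^{iθa}`
  -- or of `e^{-iθa}`, according to the sign of `n`.
  set z : Bool → ℂ := fun t => if t then θ * Complex.I else -(θ * Complex.I) with hz
  set t : ℤ → Bool := fun n => decide (0 ≤ n) with ht
  have hzt : ∀ n : ℤ, (n.natAbs : ℂ) * z (t n) = n * (θ * Complex.I) := by
    intro n
    rcases le_or_gt 0 n with hn0 | hn0
    · lift n to ℕ using hn0
      simp [hz, ht]
    · obtain ⟨k, rfl⟩ := Int.eq_ofNat_of_zero_le (neg_nonneg.2 hn0.le) |>.imp fun k hk =>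
        (neg_eq_iff_eq_neg.1 hk)
      have : ¬ (0 ≤ -(k : ℤ)) := not_le.2 hn0
      simp only [ht, hz, this]
      simp
  have hnorm : ∀ s, ∀ w ∈ spectrum ℂ a, ‖Complex.exp (z s * w)‖ = 1 := by
    intro s w hw
    rw [← hre w hw, Complex.norm_exp]
    cases s <;> simp [hz]
  -- Here `ρ = 1` is essential: the Fourier coefficients decay rapidly but need not decay
  -- exponentially.
  refine isSmooth_of_hasSum_pow (x := fun s => NormedSpace.exp (z s • a)) (ρ := 1)
    (fun s => (h.smul (z s)).exp) le_rfl (fun s => ?_) (c := c) t Int.natAbs (fun k => ?_) ?_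
  · rw [← cfc_exp_eq ha]
    exact norm_cfc_le zero_le_one fun w hw => (hnorm s w hw).le
  · simpa [Nat.cast_natAbs] using hc k
  -- The series converges uniformly on the spectrum by the Weierstrass test, so the functional
  -- calculus turns it into a norm-convergent sum.
  · have hF := tendsto_cfc_fun (a := a) (l := Filter.atTop)
      (F := fun (s : Finset ℤ) (w : ℂ) => ∑ n ∈ s, c n * Complex.exp (z (t n) * w) ^ n.natAbs)
      (f := fun w : ℂ => f w.re) ?_
      (Filter.Eventually.of_forall fun s => by fun_prop)
    · refine hF.congr fun s => ?_
      have hfun : (fun w : ℂ => ∑ n ∈ s, c n * Complex.exp (z (t n) * w) ^ n.natAbs)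
          = ∑ n ∈ s, fun w : ℂ => c n * Complex.exp (z (t n) * w) ^ n.natAbs := by
        ext w; simp
      rw [hfun, cfc_sum _ a s fun n _ => by fun_prop]
      refine Finset.sum_congr rfl fun n _ => ?_
      rw [cfc_const_mul _ _ a (by fun_prop), cfc_pow _ _ a (by fun_prop), cfc_exp_eq ha]
    · have hu : Summable fun n => ‖c n‖ := by simpa using hc 0
      refine (tendstoUniformlyOn_tsum (f := fun (n : ℤ) (w : ℂ) =>
        c n * Complex.exp (z (t n) * w) ^ n.natAbs) hu fun n w hw => ?_).congr_right fun w hw => ?_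
      · rw [norm_mul, norm_pow, hnorm _ w hw, one_pow, mul_one]
      · have h1 := hsum _ (Set.mem_image_of_mem _ hw)
        rw [hre w hw] at h1
        rw [h1]
        refine tsum_congr fun n => ?_
        rw [← Complex.exp_nat_mul, ← mul_assoc, hzt, mul_assoc]

end BunceDeddens

end

theorem mainTheorem3 (S : BunceDeddens.Supernatural) (hS : S.IsInfinite)
    (a : BunceDeddens.HPlus →L[ℂ] BunceDeddens.HPlus) (ha : a ∈ BunceDeddens.smoothBDT S)
    (hsa : IsSelfAdjoint a)
    (W : Set ℝ) (hW : IsOpen W) (haW : spectrum ℝ a ⊆ W)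
    (f : ℝ → ℂ) (hf : ContDiffOn ℝ ∞ f W) :
    cfc (fun z : ℂ => f z.re) a ∈ BunceDeddens.smoothBDT S := by
  obtain ⟨l, hl, hla⟩ := BunceDeddens.exists_isSmooth_of_mem_smoothBDT ha
  have hclosed : IsClosed
      (BunceDeddens.BDT S : Set (BunceDeddens.HPlus →L[ℂ] BunceDeddens.HPlus)) :=
    StarSubalgebra.isClosed_topologicalClosure _
  -- Membership in `BDT S` holds because the continuous functional calculus stays inside a closed
  -- star subalgebra.
  exact (hla.cfc hsa hW haW hf).mem_smoothBDT hl (cfc_mem (hs := hclosed) _ ha.1)
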